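/- Let $n$ and $m$ be natural numbers, let $u_1,\dots,u_m$ be unit vectors in $\mathbb{R}^n$ and let $c_1,\dots,c_m>0$ be such that $$\sum_{i=1}^m c_i\, u_i\otimes u_i = I_n,$$ where $u_i\otimes u_i$ is the operator $x\mapsto \langle u_i,x\rangle u_i$ on $\mathbb{R}^n$ and $I_n$ is the identity operator. Let $\alpha_1,\dots,\alpha_m>0$ and let $1\le p<\infty$ be real. For $x\in\mathbb{R}^n$ set $$\|x\| = \Big(\sum_{i=1}^m \alpha_i\,|\langle u_i,x\rangle|^p\Big)^{1/p},$$ and let $K=\{x\in\mathbb{R}^n : \|x\|\le 1\}$ be the unit ball of the normed space $(\mathbb{R}^n,\|\cdot\|)$. Then the $n$-dimensional Lebesgue measure $|K|$ of $K$ satisfies $$|K| \le \frac{2^n\,\Gamma(1+\tfrac1p)^n}{\Gamma(1+\tfrac np)}\,\prod_{i=1}^m\Big(\frac{c_i}{\alpha_i}\Big)^{c_i/p}.$$ -/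

import Mathlib

/-- The function `x ↦ (∑ i, α i * |⟨u i, x⟩| ^ p) ^ (1 / p)` on `ℝⁿ`. -/
noncomputable def weightedLpNorm {n m : ℕ} (α : Fin m → ℝ)
    (u : Fin m → EuclideanSpace ℝ (Fin n)) (p : ℝ) (x : EuclideanSpace ℝ (Fin n)) : ℝ :=
  (∑ i, α i * |inner ℝ (u i) x| ^ p) ^ (1 / p)

/-! Homogeneity gives |K| Γ(1 + n/p) = ∫ exp(-‖x‖^p). The integrand is ∏ f_i(⟨u_i, x⟩)^{c_i} with
f_i(t) = exp(-(α_i/c_i)|t|^p), so the geometric Brascamp–Lieb inequality bounds the integral by ∏ (∫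
f_i)^{c_i}; these are Gamma integrals, and ∑ c_i = n collects the constants.

Brascamp–Lieb is proved by transport. Let T_i carry f_i / ∫ f_i to the Gaussian exp(-πs²), and put
F(x) = ∑ c_i T_i(⟨u_i, x⟩) u_i. Then F is injective, det F' ≥ ∏ (T_i')^{c_i} and ‖F‖² ≤ ∑ c_i T_i².
A change of variables bounds the integral by ∏ (∫ f_i)^{c_i} times the Gaussian mass of the image of
F, which is at most 1. -/

open MeasureTheory Filter Topology Set in
theorem hasDerivAt_integral_Iic {f : ℝ → ℝ} (hf : Continuous f) (hfi : Integrable f) (t : ℝ) :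
    HasDerivAt (fun s => ∫ x in Iic s, f x) (f t) t := by
  have h : (fun s => ∫ x in Iic s, f x) = fun s => (∫ x in Iic 0, f x) + ∫ x in (0 : ℝ)..s, f x := by
    ext s
    rw [← intervalIntegral.integral_Iic_sub_Iic hfi.integrableOn hfi.integrableOn]
    ring
  rw [h]
  exact (intervalIntegral.integral_hasDerivAt_right (hf.intervalIntegrable _ _)
    (hf.stronglyMeasurableAtFilter _ _) hf.continuousAt).const_add _

open MeasureTheory Filter Topology Set in
theorem strictMono_integral_Iic {f : ℝ → ℝ} (hf : Continuous f) (hfi : Integrable f)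
    (hpos : ∀ x, 0 < f x) : StrictMono (fun s => ∫ x in Iic s, f x) :=
  strictMono_of_hasDerivAt_pos (hasDerivAt_integral_Iic hf hfi) hpos

open MeasureTheory Filter Topology Set in
theorem tendsto_integral_Iic_atTop {f : ℝ → ℝ} (hfi : Integrable f) :
    Tendsto (fun s => ∫ x in Iic s, f x) atTop (𝓝 (∫ x, f x)) :=
  (aecover_Iic tendsto_id).integral_tendsto_of_countably_generated hfi

open MeasureTheory Filter Topology Set in
theorem tendsto_integral_Iic_atBot {f : ℝ → ℝ} (hfi : Integrable f) :
    Tendsto (fun s => ∫ x in Iic s, f x) atBot (𝓝 0) := by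
  have h := (aecover_Ioi (μ := volume) (tendsto_id (α := ℝ) (x := atBot))).integral_tendsto_of_countably_generated hfi
  have h2 := h.const_sub (∫ x, f x)
  rw [sub_self] at h2
  refine h2.congr fun s => ?_
  have := integral_add_compl (measurableSet_Iic (a := s)) hfi
  rw [compl_Iic] at this
  simp only [id]
  linarith

open MeasureTheory Filter Topology Set in
theorem range_integral_Iic {f : ℝ → ℝ} (hf : Continuous f) (hfi : Integrable f)
    (hpos : ∀ x, 0 < f x) :
    range (fun s => ∫ x in Iic s, f x) = Ioo 0 (∫ x, f x) := by
  have hm := strictMono_integral_Iic hf hfi hpos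
  have hc : Continuous (fun s => ∫ x in Iic s, f x) :=
    continuous_iff_continuousAt.2 fun t => (hasDerivAt_integral_Iic hf hfi t).continuousAt
  apply Subset.antisymm
  · rintro _ ⟨s, rfl⟩
    exact ⟨(hm.monotone.le_of_tendsto (tendsto_integral_Iic_atBot hfi) (s - 1)).trans_lt
        (hm (sub_one_lt s)),
      (hm (lt_add_one s)).trans_le (hm.monotone.ge_of_tendsto (tendsto_integral_Iic_atTop hfi) (s + 1))⟩
  · rintro y ⟨h0, h1⟩
    obtain ⟨a, ha⟩ := ((tendsto_integral_Iic_atBot hfi).eventually (gt_mem_nhds h0)).exists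
    obtain ⟨b, hb⟩ := ((tendsto_integral_Iic_atTop hfi).eventually (lt_mem_nhds h1)).exists
    exact mem_range_of_exists_le_of_exists_ge hc ⟨a, ha.le⟩ ⟨b, hb.le⟩

open MeasureTheory Filter Topology Set in
/-- Monotone transport of a positive continuous probability density `f` to another one, `g`. -/
theorem exists_transport {f g : ℝ → ℝ} (hf : Continuous f) (hfi : Integrable f)
    (hfpos : ∀ x, 0 < f x) (hg : Continuous g) (hgi : Integrable g) (hgpos : ∀ x, 0 < g x)
    (hfg : ∫ x, f x = ∫ x, g x) :
    ∃ T : ℝ → ℝ, ∀ t, HasDerivAt T (f t / g (T t)) t := by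
  set F := fun s => ∫ x in Iic s, f x with hF
  set G := fun s => ∫ x in Iic s, g x with hG
  have hGm : StrictMono G := strictMono_integral_Iic hg hgi hgpos
  refine ⟨fun t => Function.invFun G (F t), fun t => ?_⟩
  -- Equal total masses give both distribution functions the same range, so `invFun` returns a
  -- genuine preimage.
  have ht : F t ∈ range G := by
    rw [range_integral_Iic hg hgi hgpos, ← hfg, ← range_integral_Iic hf hfi hfpos]
    exact mem_range_self t
  obtain ⟨s, hs⟩ := ht
  have hinv := Function.leftInverse_invFun hGm.injective
  have hstrict : HasStrictDerivAt G (g s) s :=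
    hasStrictDerivAt_of_hasDerivAt_of_continuousAt
      (Eventually.of_forall (hasDerivAt_integral_Iic hg hgi)) hg.continuousAt
  have hd : HasDerivAt (Function.invFun G) (g s)⁻¹ (F t) := by
    rw [← hs]
    exact (hstrict.to_local_left_inverse (hgpos s).ne' (Eventually.of_forall hinv)).hasDerivAt
  have := hd.comp t (hasDerivAt_integral_Iic hf hfi t)
  have e : Function.invFun G (F t) = s := by rw [← hs]; exact hinv s
  simp only [e]
  rw [div_eq_inv_mul]
  exact this

/-! ### Consequences of the decomposition of the identity -/

theorem sum_weight_mul_inner_sq {ι E : Type*} [Fintype ι] [NormedAddCommGroup E]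
    [InnerProductSpace ℝ E] {u : ι → E} {c : ι → ℝ}
    (h : ∀ x, ∑ i, (c i * inner ℝ (u i) x) • u i = x) (x : E) :
    ∑ i, c i * (inner ℝ (u i) x) ^ 2 = ‖x‖ ^ 2 := by
  conv_rhs => rw [← real_inner_self_eq_norm_sq]; rhs; rw [← h x]
  rw [inner_sum]
  refine Finset.sum_congr rfl fun i _ => ?_
  rw [inner_smul_right, real_inner_comm]; ring

open Module in
theorem sum_weight_eq_finrank {ι E : Type*} [Fintype ι] [NormedAddCommGroup E]
    [InnerProductSpace ℝ E] [FiniteDimensional ℝ E] {u : ι → E} {c : ι → ℝ}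
    (hu : ∀ i, ‖u i‖ = 1) (h : ∀ x, ∑ i, (c i * inner ℝ (u i) x) • u i = x) :
    ∑ i, c i = finrank ℝ E := by
  let b := stdOrthonormalBasis ℝ E
  have h1 : ∀ i, c i = ∑ j, c i * (inner ℝ (u i) (b j)) ^ 2 := fun i => by
    rw [← Finset.mul_sum, b.sum_sq_inner_left, hu]; simp
  rw [Finset.sum_congr rfl fun i _ => h1 i, Finset.sum_comm]
  simp [sum_weight_mul_inner_sq h]

/-- Dual to ∑ c_i ⟨u_i, x⟩² = ‖x‖²: the map on s is the adjoint of an isometry into weighted ℓ²,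
hence a contraction. -/
theorem norm_sq_sum_smul_le {ι E : Type*} [Fintype ι] [NormedAddCommGroup E]
    [InnerProductSpace ℝ E] {u : ι → E} {c : ι → ℝ} (hc : ∀ i, 0 < c i)
    (h : ∀ x, ∑ i, (c i * inner ℝ (u i) x) • u i = x) (s : ι → ℝ) :
    ‖∑ i, (c i * s i) • u i‖ ^ 2 ≤ ∑ i, c i * s i ^ 2 := by
  set y := ∑ i, (c i * s i) • u i with hy
  have h1 : ‖y‖ ^ 2 = ∑ i, c i * (s i * inner ℝ (u i) y) := by
    rw [← real_inner_self_eq_norm_sq]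
    conv_lhs => lhs; rw [hy]
    rw [sum_inner]
    refine Finset.sum_congr rfl fun i _ => ?_
    rw [inner_smul_left]; simp [mul_assoc]
  have h2 : ∑ i, c i * (s i * inner ℝ (u i) y) ≤
      ∑ i, (c i * s i ^ 2 + c i * (inner ℝ (u i) y) ^ 2) / 2 := by
    refine Finset.sum_le_sum fun i _ => ?_
    nlinarith [mul_nonneg (hc i).le (sq_nonneg (s i - inner ℝ (u i) y))]
  rw [← Finset.sum_div, Finset.sum_add_distrib, sum_weight_mul_inner_sq h] at h2
  linarith

-- In an orthonormal eigenbasis b_j, each eigenvalue is the mean of the t_i with weights c_i ⟨u_i,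
-- b_j⟩², of sum 1 over i. Apply AM–GM to each and multiply: over j the weights sum to c_i.
open Module InnerProductSpace in
theorem prod_rpow_le_det_sum_rankOne {ι E : Type*} [Fintype ι] [NormedAddCommGroup E]
    [InnerProductSpace ℝ E] [FiniteDimensional ℝ E] {u : ι → E} {c : ι → ℝ}
    (hu : ∀ i, ‖u i‖ = 1) (hc : ∀ i, 0 < c i)
    (h : ∀ x, ∑ i, (c i * inner ℝ (u i) x) • u i = x) {t : ι → ℝ} (ht : ∀ i, 0 < t i) :
    ∏ i, t i ^ c i ≤ (∑ i, (c i * t i) • rankOne ℝ (u i) (u i)).det := by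
  set A : E →L[ℝ] E := ∑ i, (c i * t i) • rankOne ℝ (u i) (u i) with hA
  have hAx : ∀ x, A x = ∑ i, (c i * t i * inner ℝ (u i) x) • u i := fun x => by
    simp [hA, mul_smul]
  have hsym : (A : E →ₗ[ℝ] E).IsSymmetric := fun x y => by
    simp only [ContinuousLinearMap.coe_coe, hAx, sum_inner, inner_sum, inner_smul_left,
      inner_smul_right]
    refine Finset.sum_congr rfl fun i _ => ?_
    rw [real_inner_comm x]; simp; ring
  set b := hsym.eigenvectorBasis rfl
  have hev : ∀ j, hsym.eigenvalues rfl j = ∑ i, c i * (inner ℝ (u i) (b j)) ^ 2 * t i := fun j => by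
    have h1 : inner ℝ (b j) (A (b j)) = hsym.eigenvalues rfl j := by
      have := hsym.apply_eigenvectorBasis rfl j
      rw [ContinuousLinearMap.coe_coe] at this
      rw [this, inner_smul_right, real_inner_self_eq_norm_sq]
      simp
    rw [← h1, hAx, inner_sum]
    refine Finset.sum_congr rfl fun i _ => ?_
    rw [inner_smul_right, real_inner_comm]; ring
  have hle : ∀ j, ∏ i, t i ^ (c i * (inner ℝ (u i) (b j)) ^ 2) ≤ hsym.eigenvalues rfl j := fun j => by
    rw [hev]
    refine Real.geom_mean_le_arith_mean_weighted _ _ _ (fun i _ => ?_) ?_ fun i _ => (ht i).le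
    · exact mul_nonneg (hc i).le (sq_nonneg _)
    · rw [sum_weight_mul_inner_sq h]; simp
  have hdet : A.det = ∏ j, hsym.eigenvalues rfl j := hsym.det_eq_prod_eigenvalues rfl
  rw [hdet]
  calc ∏ i, t i ^ c i = ∏ i, ∏ j, t i ^ (c i * (inner ℝ (u i) (b j)) ^ 2) := by
        refine Finset.prod_congr rfl fun i _ => ?_
        rw [← Real.rpow_sum_of_pos (ht i), ← Finset.mul_sum, b.sum_sq_inner_left, hu]; simp
    _ = ∏ j, ∏ i, t i ^ (c i * (inner ℝ (u i) (b j)) ^ 2) := Finset.prod_comm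
    _ ≤ _ := Finset.prod_le_prod
        (fun j _ => Finset.prod_nonneg fun i _ => Real.rpow_nonneg (ht i).le _) fun j _ => hle j

/-! ### The Brascamp–Lieb inequality by transport -/

open MeasureTheory InnerProductSpace Real in
/-- The geometric Brascamp–Lieb inequality for continuous positive integrable functions. -/
theorem lintegral_prod_rpow_le_prod_integral_rpow {ι E : Type*} [Fintype ι] [NormedAddCommGroup E]
    [InnerProductSpace ℝ E] [FiniteDimensional ℝ E] [MeasurableSpace E] [BorelSpace E]
    {u : ι → E} {c : ι → ℝ} (hu : ∀ i, ‖u i‖ = 1) (hc : ∀ i, 0 < c i)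
    (h : ∀ x, ∑ i, (c i * inner ℝ (u i) x) • u i = x) {f : ι → ℝ → ℝ}
    (hf : ∀ i, Continuous (f i)) (hfi : ∀ i, Integrable (f i)) (hpos : ∀ i t, 0 < f i t) :
    ∫⁻ x : E, ENNReal.ofReal (∏ i, f i (inner ℝ (u i) x) ^ c i) ≤
      ENNReal.ofReal (∏ i, (∫ t, f i t) ^ c i) := by
  have hA : ∀ i, 0 < ∫ t, f i t := fun i => by
    rw [integral_pos_iff_support_of_nonneg (fun t => (hpos i t).le) (hfi i),
      show Function.support (f i) = Set.univ from Set.eq_univ_of_forall fun t => (hpos i t).ne']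
    simp
  obtain ⟨A, hAf⟩ : ∃ A : ι → ℝ, ∀ i, ∫ t, f i t = A i := ⟨_, fun _ => rfl⟩
  simp only [hAf] at hA ⊢
  -- The factor π gives mass 1 in every dimension.
  set γ : ℝ → ℝ := fun s => exp (-π * s ^ 2) with hγ
  have hγpos : ∀ s, 0 < γ s := fun s => exp_pos _
  have hγint : ∫ s, γ s = 1 := by rw [hγ, integral_gaussian, div_self pi_ne_zero, sqrt_one]
  have htrans : ∀ i, ∃ T : ℝ → ℝ, ∀ t, HasDerivAt T (f i t / A i / γ (T t)) t := fun i =>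
    exists_transport ((hf i).div_const _) ((hfi i).div_const _) (fun t => div_pos (hpos i t) (hA i))
      (by fun_prop) (integrable_exp_neg_mul_sq pi_pos) hγpos
      (by rw [integral_div, hγint, hAf, div_self (hA i).ne'])
  choose T hT using htrans
  set T' : ι → ℝ → ℝ := fun i t => f i t / A i / γ (T i t)
  have hT' : ∀ i t, 0 < T' i t := fun i t => div_pos (div_pos (hpos i t) (hA i)) (hγpos _)
  set F : E → E := fun x => ∑ i, (c i * T i (inner ℝ (u i) x)) • u i with hF
  set F' : E → E →L[ℝ] E :=
    fun x => ∑ i, (c i * T' i (inner ℝ (u i) x)) • rankOne ℝ (u i) (u i) with hF'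
  have hderiv : ∀ x, HasFDerivAt F (F' x) x := fun x => by
    refine HasFDerivAt.fun_sum fun i _ => ?_
    have h1 : HasFDerivAt (fun x : E => inner ℝ (u i) x) (innerSL ℝ (u i)) x :=
      (innerSL ℝ (u i)).hasFDerivAt
    have h2 := (((hT i (inner ℝ (u i) x)).comp_hasFDerivAt x h1).const_mul (c i)).smul_const (u i)
    refine h2.congr_fderiv ?_
    ext y
    simp [mul_smul, T']
  have hmono : ∀ i, StrictMono (T i) := fun i => strictMono_of_hasDerivAt_pos (hT i) (hT' i)
  -- Pairing F x - F y with x - y gives a sum of terms nonnegative by monotonicity; all vanish, so x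
  -- and y have the same ⟨u_i, ·⟩.
  have hinj : Function.Injective F := fun x y hxy => by
    have h0 : ∑ i, c i * ((T i (inner ℝ (u i) x) - T i (inner ℝ (u i) y)) *
        (inner ℝ (u i) x - inner ℝ (u i) y)) = 0 := by
      have : inner ℝ (F x - F y) (x - y) = 0 := by rw [hxy]; simp
      rw [← this, hF]
      simp only [← Finset.sum_sub_distrib, sum_inner, ← sub_smul, inner_smul_left, inner_sub_right]
      refine Finset.sum_congr rfl fun i _ => ?_
      simp; ring
    have hnn : ∀ i t s, 0 ≤ (T i t - T i s) * (t - s) := fun i t s => by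
      rcases le_total t s with hts | hts
      · exact mul_nonneg_of_nonpos_of_nonpos (sub_nonpos.2 ((hmono i).monotone hts))
          (sub_nonpos.2 hts)
      · exact mul_nonneg (sub_nonneg.2 ((hmono i).monotone hts)) (sub_nonneg.2 hts)
    rw [Finset.sum_eq_zero_iff_of_nonneg fun i _ => mul_nonneg (hc i).le (hnn i _ _)] at h0
    rw [← h x, ← h y]
    refine Finset.sum_congr rfl fun i hi => ?_
    rcases mul_eq_zero.1 ((mul_eq_zero.1 (h0 i hi)).resolve_left (hc i).ne') with h1 | h1
    · rw [(hmono i).injective (sub_eq_zero.1 h1)]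
    · rw [sub_eq_zero.1 h1]
  have hpoint : ∀ x : E, ∏ i, f i (inner ℝ (u i) x) ^ c i ≤
      (∏ i, A i ^ c i) * (|(F' x).det| * exp (-π * ‖F x‖ ^ 2)) := fun x => by
    have h1 : ∀ i, f i (inner ℝ (u i) x) ^ c i = A i ^ c i * (T' i (inner ℝ (u i) x) ^ c i *
        exp (-π * (c i * T i (inner ℝ (u i) x) ^ 2))) := fun i => by
      have : f i (inner ℝ (u i) x) =
          A i * (T' i (inner ℝ (u i) x) * γ (T i (inner ℝ (u i) x))) := by
        have := (hA i).ne'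
        have := (hγpos (T i (inner ℝ (u i) x))).ne'
        simp only [T']
        field_simp
      rw [this, mul_rpow (hA i).le (mul_pos (hT' i _) (hγpos _)).le,
        mul_rpow (hT' i _).le (hγpos _).le, ← exp_mul]
      ring_nf
    simp_rw [h1, Finset.prod_mul_distrib, ← exp_sum, ← Finset.mul_sum]
    refine mul_le_mul_of_nonneg_left (mul_le_mul ?_ ?_ (exp_pos _).le (abs_nonneg _))
      (Finset.prod_nonneg fun i _ => rpow_nonneg (hA i).le _)
    · exact (prod_rpow_le_det_sum_rankOne hu hc h fun i => hT' i _).trans (le_abs_self _)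
    · have := norm_sq_sum_smul_le hc h fun i => T i (inner ℝ (u i) x)
      exact exp_le_exp.2 (mul_le_mul_of_nonpos_left this (neg_nonpos.2 pi_pos.le))
  have hprod : 0 ≤ ∏ i, A i ^ c i := Finset.prod_nonneg fun i _ => rpow_nonneg (hA i).le _
  have hgauss : ∫⁻ y : E, ENNReal.ofReal (exp (-π * ‖y‖ ^ 2)) = 1 := by
    have h1 := GaussianFourier.integral_rexp_neg_mul_sq_norm (V := E) pi_pos
    rw [div_self pi_ne_zero, one_rpow] at h1
    rw [← ofReal_integral_eq_lintegral_ofReal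
      (Integrable.of_integral_ne_zero (by rw [h1]; exact one_ne_zero))
      (ae_of_all _ fun y => (exp_pos _).le), h1, ENNReal.ofReal_one]
  calc ∫⁻ x : E, ENNReal.ofReal (∏ i, f i (inner ℝ (u i) x) ^ c i)
      ≤ ∫⁻ x : E, ENNReal.ofReal (∏ i, A i ^ c i) *
          (ENNReal.ofReal |(F' x).det| * ENNReal.ofReal (exp (-π * ‖F x‖ ^ 2))) := by
        refine lintegral_mono fun x => ?_
        rw [← ENNReal.ofReal_mul (abs_nonneg _), ← ENNReal.ofReal_mul hprod]
        exact ENNReal.ofReal_le_ofReal (hpoint x)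
    _ = ENNReal.ofReal (∏ i, A i ^ c i) *
          ∫⁻ x : E, ENNReal.ofReal |(F' x).det| * ENNReal.ofReal (exp (-π * ‖F x‖ ^ 2)) :=
        lintegral_const_mul' _ _ ENNReal.ofReal_ne_top
    _ = ENNReal.ofReal (∏ i, A i ^ c i) *
          ∫⁻ y in F '' Set.univ, ENNReal.ofReal (exp (-π * ‖y‖ ^ 2)) := by
        rw [lintegral_image_eq_lintegral_abs_det_fderiv_mul volume MeasurableSet.univ
          (fun x _ => (hderiv x).hasFDerivWithinAt) hinj.injOn, setLIntegral_univ]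
    _ ≤ ENNReal.ofReal (∏ i, A i ^ c i) * ∫⁻ y : E, ENNReal.ofReal (exp (-π * ‖y‖ ^ 2)) := by
        gcongr
        exact Measure.restrict_le_self
    _ = ENNReal.ofReal (∏ i, A i ^ c i) := by rw [hgauss, mul_one]

/-! ### Gamma integrals and the weighted norm -/

open MeasureTheory Real in
theorem integral_exp_neg_mul_abs_rpow {p b : ℝ} (hp : 0 < p) (hb : 0 < b) :
    ∫ t : ℝ, exp (-b * |t| ^ p) = 2 * (b ^ (-1 / p) * Gamma (1 / p + 1)) := by
  rw [integral_comp_abs (f := fun t => exp (-b * t ^ p)), integral_exp_neg_mul_rpow hp hb]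

open MeasureTheory Real in
theorem integrable_exp_neg_mul_abs_rpow {p b : ℝ} (hp : 0 < p) (hb : 0 < b) :
    Integrable fun t : ℝ => exp (-b * |t| ^ p) := by
  refine Integrable.of_integral_ne_zero ?_
  rw [integral_exp_neg_mul_abs_rpow hp hb]
  have := Gamma_pos_of_pos (show 0 < 1 / p + 1 by positivity)
  positivity

section weightedLpNorm

variable {n m : ℕ} {α : Fin m → ℝ} {u : Fin m → EuclideanSpace ℝ (Fin n)} {p : ℝ}

theorem weightedLpNorm_rpow (hα : ∀ i, 0 < α i) (hp : 0 < p) (x : EuclideanSpace ℝ (Fin n)) :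
    weightedLpNorm α u p x ^ p = ∑ i, α i * |inner ℝ (u i) x| ^ p := by
  rw [weightedLpNorm, ← Real.rpow_mul, one_div_mul_cancel hp.ne', Real.rpow_one]
  exact Finset.sum_nonneg fun i _ => mul_nonneg (hα i).le (by positivity)

theorem weightedLpNorm_zero (hp : 0 < p) : weightedLpNorm α u p 0 = 0 := by
  simp [weightedLpNorm, Real.zero_rpow hp.ne', Real.zero_rpow (inv_pos.2 hp).ne']

theorem weightedLpNorm_neg (x : EuclideanSpace ℝ (Fin n)) :
    weightedLpNorm α u p (-x) = weightedLpNorm α u p x := by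
  simp [weightedLpNorm]

theorem weightedLpNorm_smul (hα : ∀ i, 0 < α i) (hp : 0 < p) (r : ℝ)
    (x : EuclideanSpace ℝ (Fin n)) :
    weightedLpNorm α u p (r • x) = |r| * weightedLpNorm α u p x := by
  have h : ∑ i, α i * |inner ℝ (u i) (r • x)| ^ p =
      |r| ^ p * ∑ i, α i * |inner ℝ (u i) x| ^ p := by
    rw [Finset.mul_sum]
    refine Finset.sum_congr rfl fun i _ => ?_
    rw [inner_smul_right, abs_mul, Real.mul_rpow (abs_nonneg _) (abs_nonneg _)]
    ring
  rw [weightedLpNorm, h, Real.mul_rpow (by positivity)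
    (Finset.sum_nonneg fun i _ => mul_nonneg (hα i).le (by positivity)),
    ← Real.rpow_mul (abs_nonneg _), mul_one_div_cancel hp.ne', Real.rpow_one, weightedLpNorm]

theorem weightedLpNorm_add_le (hα : ∀ i, 0 < α i) (hp : 1 ≤ p)
    (x y : EuclideanSpace ℝ (Fin n)) :
    weightedLpNorm α u p (x + y) ≤ weightedLpNorm α u p x + weightedLpNorm α u p y := by
  have hp0 : 0 < p := by linarith
  -- Absorbing α_i^{1/p} into the coordinates reduces to Minkowski in ℓ^p.
  have h : ∀ z, weightedLpNorm α u p z =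
      (∑ i, |α i ^ (1 / p) * inner ℝ (u i) z| ^ p) ^ (1 / p) := fun z => by
    rw [weightedLpNorm]
    congr 1
    refine Finset.sum_congr rfl fun i _ => ?_
    rw [abs_mul, Real.mul_rpow (abs_nonneg _) (abs_nonneg _),
      abs_of_nonneg (Real.rpow_nonneg (hα i).le _), ← Real.rpow_mul (hα i).le,
      one_div_mul_cancel hp0.ne', Real.rpow_one]
  simp only [h, inner_add_right, mul_add]
  exact Real.Lp_add_le _ _ _ hp

theorem inner_eq_zero_of_weightedLpNorm_eq_zero (hα : ∀ i, 0 < α i) (hp : 0 < p)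
    {x : EuclideanSpace ℝ (Fin n)} (hx : weightedLpNorm α u p x = 0) (i : Fin m) :
    inner ℝ (u i) x = 0 := by
  have h := weightedLpNorm_rpow (u := u) hα hp x
  rw [hx, Real.zero_rpow hp.ne', eq_comm, Finset.sum_eq_zero_iff_of_nonneg
    fun i _ => mul_nonneg (hα i).le (by positivity)] at h
  have h1 := (mul_eq_zero.1 (h i (Finset.mem_univ i))).resolve_left (hα i).ne'
  exact abs_eq_zero.1 ((Real.rpow_eq_zero (abs_nonneg _) hp.ne').1 h1)

open MeasureTheory Real in
theorem integral_exp_neg_weightedLpNorm_rpow_le {c : Fin m → ℝ} (hu : ∀ i, ‖u i‖ = 1)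
    (hc : ∀ i, 0 < c i) (h : ∀ x, ∑ i, (c i * inner ℝ (u i) x) • u i = x) (hα : ∀ i, 0 < α i)
    (hp : 0 < p) :
    ∫ x, exp (-weightedLpNorm α u p x ^ p) ≤
      2 ^ n * Gamma (1 + 1 / p) ^ n * ∏ i, (c i / α i) ^ (c i / p) := by
  have hb : ∀ i, 0 < α i / c i := fun i => div_pos (hα i) (hc i)
  have hG : 0 < Gamma (1 + 1 / p) := Gamma_pos_of_pos (by positivity)
  have hexp : ∀ x : EuclideanSpace ℝ (Fin n), exp (-weightedLpNorm α u p x ^ p) =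
      ∏ i, exp (-(α i / c i) * |inner ℝ (u i) x| ^ p) ^ c i := fun x => by
    rw [weightedLpNorm_rpow hα hp, ← Finset.sum_neg_distrib, exp_sum]
    refine Finset.prod_congr rfl fun i _ => ?_
    rw [← exp_mul]
    have := (hc i).ne'
    congr 1
    field_simp
  have hBL := lintegral_prod_rpow_le_prod_integral_rpow hu hc h
    (f := fun i t => exp (-(α i / c i) * |t| ^ p))
    (fun i => continuous_exp.comp (continuous_const.mul
      (continuous_abs.rpow_const fun _ => Or.inr hp.le)))
    (fun i => integrable_exp_neg_mul_abs_rpow hp (hb i)) (fun i t => exp_pos _)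
  have hrhs : ∏ i, (∫ t : ℝ, exp (-(α i / c i) * |t| ^ p)) ^ c i =
      2 ^ n * Gamma (1 + 1 / p) ^ n * ∏ i, (c i / α i) ^ (c i / p) := by
    have h1 : ∀ i, (∫ t : ℝ, exp (-(α i / c i) * |t| ^ p)) ^ c i =
        (2 * Gamma (1 + 1 / p)) ^ c i * (c i / α i) ^ (c i / p) := fun i => by
      rw [integral_exp_neg_mul_abs_rpow hp (hb i), add_comm (1 / p) 1, mul_left_comm, mul_comm,
        mul_rpow (by positivity) (rpow_nonneg (hb i).le _), ← rpow_mul (hb i).le,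
        ← inv_div (α i) (c i), inv_rpow (hb i).le, ← rpow_neg (hb i).le]
      ring_nf
    simp_rw [h1, Finset.prod_mul_distrib]
    rw [← rpow_sum_of_pos (by positivity), sum_weight_eq_finrank hu h, finrank_euclideanSpace_fin,
      rpow_natCast, mul_pow]
  rw [hrhs] at hBL
  rw [integral_eq_lintegral_of_nonneg_ae (ae_of_all _ fun x => (exp_pos _).le)]
  · refine ENNReal.toReal_le_of_le_ofReal ?_ (by simpa only [hexp] using hBL)
    exact mul_nonneg (by positivity) (Finset.prod_nonneg fun i _ =>
      rpow_nonneg (div_pos (hc i) (hα i)).le _)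
  · simp_rw [weightedLpNorm_rpow hα hp]
    refine (continuous_exp.comp (continuous_finsetSum _ fun i _ => continuous_const.mul
      (Continuous.rpow_const ?_ fun _ => Or.inr hp.le)).neg).aestronglyMeasurable
    fun_prop

end weightedLpNorm

/-! ### The volume bound -/

theorem proposition8 (n m : ℕ) (u : Fin m → EuclideanSpace ℝ (Fin n)) (c α : Fin m → ℝ) (p : ℝ)
    (hu : ∀ i, ‖u i‖ = 1) (hc : ∀ i, 0 < c i)
    (hdecomp : ∑ i, c i • InnerProductSpace.rankOne ℝ (u i) (u i)
      = ContinuousLinearMap.id ℝ (EuclideanSpace ℝ (Fin n)))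
    (hα : ∀ i, 0 < α i) (hp : 1 ≤ p) :
    MeasureTheory.volume {x : EuclideanSpace ℝ (Fin n) | weightedLpNorm α u p x ≤ 1} ≤
      ENNReal.ofReal
        (2 ^ n * Real.Gamma (1 + 1 / p) ^ n / Real.Gamma (1 + (n : ℝ) / p) *
          ∏ i, (c i / α i) ^ (c i / p)) := by
  have hp0 : 0 < p := by linarith
  have h : ∀ x, ∑ i, (c i * inner ℝ (u i) x) • u i = x := fun x => by
    conv_rhs => rw [← ContinuousLinearMap.id_apply (R₁ := ℝ) x, ← hdecomp]
    simp [mul_smul]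
  have hzero : ∀ {x}, weightedLpNorm α u p x = 0 → x = 0 := fun {x} hx => by
    rw [← h x]
    simp [inner_eq_zero_of_weightedLpNorm_eq_zero hα hp0 hx]
  have hsmul := fun r x => (weightedLpNorm_smul (u := u) hα hp0 r x).le
  -- The Gamma formula used below is for the open ball. Dimension 0 is separate: there both balls
  -- are the whole space.
  have hle : MeasureTheory.volume {x | weightedLpNorm α u p x ≤ 1} =
      MeasureTheory.volume {x | weightedLpNorm α u p x < 1} := by
    rcases subsingleton_or_nontrivial (EuclideanSpace ℝ (Fin n)) with hs | hs
    · congr 1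
      ext x
      simp [Subsingleton.elim x 0, weightedLpNorm_zero hp0]
    · exact MeasureTheory.measure_le_eq_lt _ (weightedLpNorm_zero hp0) weightedLpNorm_neg
        (weightedLpNorm_add_le hα hp) hzero hsmul 1
  rw [hle, MeasureTheory.measure_lt_one_eq_integral_div_gamma _ (weightedLpNorm_zero hp0)
    weightedLpNorm_neg (weightedLpNorm_add_le hα hp) hzero hsmul hp0, finrank_euclideanSpace_fin,
    add_comm _ (1 : ℝ), div_mul_eq_mul_div]
  have hG : 0 < Real.Gamma (1 + (n : ℝ) / p) := Real.Gamma_pos_of_pos (by positivity)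
  gcongr
  exact integral_exp_neg_weightedLpNorm_rpow_le hu hc h hα hp0
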